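/- Let $\beta>1$ be a real number and let $T_\beta(x)=\beta x-\lfloor\beta x\rfloor$. For $x\in[0,1)$ and $n\ge 1$ let $\varepsilon_n(x)=\lfloor\beta\,T_\beta^{\,n-1}x\rfloor$ be the $n$-th digit of the $\beta$-expansion of $x$, and let $$r_n(x)=\max\{k\ge 0:\ \varepsilon_{i+1}(x)=\cdots=\varepsilon_{i+k}(x)=0\ \text{for some}\ 0\le i\le n-k\}$$ be the length of the longest string of consecutive zeros among the first $n$ digits. Let $\phi:\{1,2,3,\dots\}\to(0,\infty)$ be nondecreasing, with $\phi(n)\to\infty$ and $$\lim_{n\to\infty}\frac{\phi(n+\lfloor\phi(n)\rfloor)}{\phi(n)}=1 .$$ Then the set $$G_\phi=\Big\{x\in[0,1):\ \limsup_{n\to\infty}\frac{r_n(x)}{\phi(n)}=1\Big\}$$ has Hausdorff dimension $1$. -/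

import Mathlib

open Filter Topology

namespace BetaExpansion

noncomputable section

/-- The `β`-transformation `T_β x = β x - ⌊β x⌋`. -/
def betaMap (β : ℝ) (x : ℝ) : ℝ := β * x - (⌊β * x⌋ : ℝ)

/-- The `n`-th digit (`n ≥ 1`) of the `β`-expansion of `x`: `ε_n(x) = ⌊β T_β^(n-1) x⌋`.
The index `n = 0` is never used. -/
def digit (β : ℝ) (x : ℝ) (n : ℕ) : ℤ := ⌊β * (betaMap β)^[n - 1] x⌋

/-- The run-length function `r_n(x)`: the maximal length `k` of a string of consecutive zeros
`ε_{i+1}(x) = ⋯ = ε_{i+k}(x) = 0` with `0 ≤ i ≤ n - k`, i.e. among the first `n` digits.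
The set contains `0` and is bounded by `n`, so this supremum in `ℕ` is a maximum. -/
def runLength (β : ℝ) (x : ℝ) (n : ℕ) : ℕ :=
  sSup {k : ℕ | ∃ i : ℕ, i + k ≤ n ∧ ∀ j : ℕ, 1 ≤ j → j ≤ k → digit β x (i + j) = 0}

/-- The class of positive nondecreasing functions `φ` on the positive integers with `φ(n) → ∞`
and `φ(n + φ(n)) / φ(n) → 1`. A non-integer argument is read through its integer part, which is the
weakest reading of the last condition: for any nondecreasing extension of `φ` to the reals,
`φ(n) ≤ φ(⌊n + φ(n)⌋) ≤ φ(n + φ(n))`. The value `φ 0` plays no role. -/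
structure SlowGrowth (φ : ℕ → ℝ) : Prop where
  pos : ∀ n : ℕ, 1 ≤ n → 0 < φ n
  mono : ∀ m n : ℕ, 1 ≤ m → m ≤ n → φ m ≤ φ n
  tendsto_atTop : Tendsto φ atTop atTop
  tendsto_ratio : Tendsto (fun n : ℕ => φ (n + ⌊φ n⌋₊) / φ n) atTop (𝓝 1)

/-- The set `G_φ` of `x ∈ [0,1)` with `limsup r_n(x) / φ(n) = 1`; the limsup is taken in the extended
reals, so that it is always meaningful. -/
def runSet (β : ℝ) (φ : ℕ → ℝ) : Set ℝ :=
  {x : ℝ | x ∈ Set.Ico (0 : ℝ) 1 ∧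
    limsup (fun n : ℕ => (((runLength β x n : ℝ) / φ n : ℝ) : EReal)) atTop = 1}

end

end BetaExpansion

namespace BetaExpansion

/-! Arbitrary digit words cannot be concatenated in a `β`-expansion, but full words can
(`add_div_mem_fullPoints`), and there are at least `β ^ L / (L + 1)` of length `L`
(`pow_le_ncard_fullPoints`). Points are built from freely chosen nonzero full words of a fixed
length `L`, separated by gaps of zeros.

The `j`-th word ends at `n = S j + L`. Infinitely many gaps have length `⌊φ n⌋`, the others length
one. Nonzero words interrupt every run, so runs are at most `φ n + O(L)`; a long gap is a run of
length `⌊φ n⌋` among the first `n + ⌊φ n⌋` digits. The ratio condition then makes the limsup `1`.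

The ratio condition also gives `φ n = o(n)`. Hence long gaps can occur infinitely often while `S j ≤
(L + 2) * j` (`frequently_positions_succ`). Points that first differ in block `j` are then at least
a constant times `β ^ (-(L + 2) * j)` apart, and more than `β ^ ((L + 2) * s)` full words are
available once `L` is large, for any `s < 1`. Reading words as `M`-adic digits gives an `s`-Hölder
map onto `[0, 1]`, so the dimension is at least `s`. -/

theorem betaMap_eq_fract (β x : ℝ) : betaMap β x = Int.fract (β * x) := rfl

theorem betaMap_iterate_of_lt {β : ℝ} (hβ : 1 < β) {n : ℕ} {y : ℝ} (hy : 0 ≤ y)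
    (hy' : y * β ^ n < 1) : (betaMap β)^[n] y = y * β ^ n := by
  induction n generalizing y with
  | zero => simp
  | succ n ih =>
    have h1 : β * y < 1 := by
      refine lt_of_le_of_lt ?_ hy'
      have : (1 : ℝ) ≤ β ^ n := one_le_pow₀ hβ.le
      have h2 : 0 ≤ β * y := by positivity
      calc β * y ≤ β * y * β ^ n := le_mul_of_one_le_right h2 this
        _ = _ := by ring
    have h2 : 0 ≤ β * y := by positivity
    rw [Function.iterate_succ_apply, betaMap_eq_fract, Int.fract_eq_self.2 ⟨h2, h1⟩, ih h2]
    · ring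
    · rw [pow_succ] at hy'; linarith

theorem betaMap_iterate_mem (β : ℝ) {x : ℝ} (hx : x ∈ Set.Ico (0 : ℝ) 1) (n : ℕ) :
    (betaMap β)^[n] x ∈ Set.Ico (0 : ℝ) 1 := by
  induction n with
  | zero => exact hx
  | succ n _ =>
    rw [Function.iterate_succ_apply', betaMap_eq_fract]
    exact ⟨Int.fract_nonneg _, Int.fract_lt_one _⟩

/-! ### Full cylinders and their number -/

/-- The left endpoints of the full cylinders of order `n` of the `β`-transformation: the cylinder
`[a, a + β⁻ⁿ)` lies in `[0, 1)` and is mapped affinely onto `[0, 1)` by the `n`-th iterate. -/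
def fullPoints (β : ℝ) (n : ℕ) : Set ℝ :=
  {a | 0 ≤ a ∧ a + 1 / β ^ n ≤ 1 ∧
    ∀ t : ℝ, 0 ≤ t → t < 1 → (betaMap β)^[n] (a + t / β ^ n) = t}

theorem zero_mem_fullPoints {β : ℝ} (hβ : 1 < β) (n : ℕ) : 0 ∈ fullPoints β n := by
  have h0 : (0 : ℝ) < β ^ n := by positivity
  refine ⟨le_rfl, ?_, fun t ht ht' => ?_⟩
  · rw [zero_add, div_le_one h0]; exact one_le_pow₀ hβ.le
  · have : t / β ^ n * β ^ n = t := div_mul_cancel₀ _ h0.ne'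
    rw [zero_add, betaMap_iterate_of_lt hβ (by positivity) (by rwa [this]), this]

theorem add_div_mem_fullPoints {β : ℝ} (hβ : 1 < β) {m n : ℕ} {a b : ℝ}
    (ha : a ∈ fullPoints β m) (hb : b ∈ fullPoints β n) :
    a + b / β ^ m ∈ fullPoints β (m + n) := by
  have hm : (0 : ℝ) < β ^ m := by positivity
  have hn : (0 : ℝ) < β ^ n := by positivity
  obtain ⟨ha0, ha1, ha2⟩ := ha
  obtain ⟨hb0, hb1, hb2⟩ := hb
  refine ⟨by positivity, ?_, fun t ht ht' => ?_⟩
  · have : (b + 1 / β ^ n) / β ^ m ≤ 1 / β ^ m := by gcongr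
    calc a + b / β ^ m + 1 / β ^ (m + n) = a + (b + 1 / β ^ n) / β ^ m := by
          rw [pow_add]; field_simp; ring
      _ ≤ _ := by linarith
  · have h1 : a + b / β ^ m + t / β ^ (m + n) = a + (b + t / β ^ n) / β ^ m := by
      rw [pow_add]; field_simp; ring
    have h2 : t / β ^ n < 1 / β ^ n := by gcongr
    have h3 : 0 ≤ t / β ^ n := by positivity
    rw [add_comm m n, Function.iterate_add_apply, add_comm n m, h1,
      ha2 _ (by linarith) (by linarith), hb2 t ht ht']

/-- Otherwise `b` lies in the cylinder of `a`, where the `n`-th iterate takes the value `(b - a) * β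
^ n > 0`; but it sends its own left endpoint `b` to `0`. -/
theorem fullPoints_separated {β : ℝ} (hβ : 1 < β) {n : ℕ} {a b : ℝ}
    (ha : a ∈ fullPoints β n) (hb : b ∈ fullPoints β n) (hab : a < b) : a + 1 / β ^ n ≤ b := by
  have hn : (0 : ℝ) < β ^ n := by positivity
  by_contra! h
  have h0 : 0 < (b - a) * β ^ n := mul_pos (by linarith) hn
  have h1 : (b - a) * β ^ n < 1 := by
    rw [← lt_div_iff₀ hn]; linarith
  have h2 := ha.2.2 _ h0.le h1
  have h3 := hb.2.2 0 le_rfl one_pos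
  rw [mul_div_cancel_right₀ _ hn.ne', add_sub_cancel] at h2
  rw [zero_div, add_zero, h2] at h3
  exact h0.ne' h3

theorem fullPoints_finite {β : ℝ} (hβ : 1 < β) (n : ℕ) : (fullPoints β n).Finite := by
  have hn : (0 : ℝ) < β ^ n := by positivity
  have hinj : Set.InjOn (fun a : ℝ => ⌊a * β ^ n⌋) (fullPoints β n) := by
    have key : ∀ a ∈ fullPoints β n, ∀ b ∈ fullPoints β n, a < b →
        ⌊a * β ^ n⌋ ≠ ⌊b * β ^ n⌋ := by
      intro a ha b hb hab h
      have h1 := mul_le_mul_of_nonneg_right (fullPoints_separated hβ ha hb hab) hn.le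
      rw [add_mul, div_mul_cancel₀ _ hn.ne'] at h1
      have h2 := Int.floor_le_floor h1
      rw [Int.floor_add_one] at h2
      omega
    intro a ha b hb hab
    rcases lt_trichotomy a b with h | h | h
    · exact absurd hab (key a ha b hb h)
    · exact h
    · exact absurd hab.symm (key b hb a ha h)
  refine Set.Finite.of_finite_image ((Set.finite_Icc (0 : ℤ) ⌊β ^ n⌋).subset ?_) hinj
  rintro _ ⟨a, ha, rfl⟩
  refine ⟨Int.floor_nonneg.2 (mul_nonneg ha.1 hn.le), Int.floor_le_floor ?_⟩
  have : 0 < 1 / β ^ n := by positivity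
  exact mul_le_of_le_one_left hn.le (by linarith [ha.2.1])

theorem fullPoints_mono {β : ℝ} (hβ : 1 < β) : Monotone (fullPoints β) := by
  refine monotone_nat_of_le_succ fun n a ha => ?_
  simpa using add_div_mem_fullPoints hβ ha (zero_mem_fullPoints hβ 1)

/-- The orbit of `1` under the left-continuous version of the `β`-transformation. -/
noncomputable def leftOrbit (β : ℝ) : ℕ → ℝ
  | 0 => 1
  | n + 1 => β * leftOrbit β n - (⌈β * leftOrbit β n⌉ - 1)

theorem leftOrbit_pos (β : ℝ) (n : ℕ) : 0 < leftOrbit β n := by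
  cases n with
  | zero => exact one_pos
  | succ n =>
    have := Int.ceil_lt_add_one (β * leftOrbit β n)
    rw [leftOrbit]; linarith

theorem leftOrbit_le_one (β : ℝ) (n : ℕ) : leftOrbit β n ≤ 1 := by
  cases n with
  | zero => exact le_rfl
  | succ n =>
    have := Int.le_ceil (β * leftOrbit β n)
    rw [leftOrbit]; linarith

/-- The left endpoint of the rightmost cylinder of order `n`. -/
noncomputable def lastPoint (β : ℝ) (n : ℕ) : ℝ := 1 - leftOrbit β n / β ^ n

theorem lastPoint_nonneg {β : ℝ} (hβ : 1 < β) (n : ℕ) : 0 ≤ lastPoint β n := by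
  have : (1 : ℝ) ≤ β ^ n := one_le_pow₀ hβ.le
  rw [lastPoint, sub_nonneg, div_le_one (by positivity)]
  exact (leftOrbit_le_one β n).trans this

theorem lastPoint_succ {β : ℝ} (hβ : 1 < β) (n : ℕ) :
    lastPoint β (n + 1) = lastPoint β n + (⌈β * leftOrbit β n⌉ - 1) / β ^ (n + 1) := by
  have : β ≠ 0 := by positivity
  rw [lastPoint, lastPoint, leftOrbit]; field_simp; ring

theorem betaMap_iterate_lastPoint {β : ℝ} (hβ : 1 < β) (n : ℕ) {t : ℝ} (ht : 0 ≤ t)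
    (ht' : t < leftOrbit β n) : (betaMap β)^[n] (lastPoint β n + t / β ^ n) = t := by
  have hb : 0 < β := by positivity
  induction n generalizing t with
  | zero => simp [lastPoint, leftOrbit]
  | succ n ih =>
    set D : ℤ := ⌈β * leftOrbit β n⌉ - 1 with hD
    have hD0 : (0 : ℤ) ≤ D := by
      have : 0 < ⌈β * leftOrbit β n⌉ := Int.ceil_pos.2 (mul_pos hb (leftOrbit_pos β n))
      omega
    have hD0' : (0 : ℝ) ≤ D := by exact_mod_cast hD0
    have h1 : lastPoint β (n + 1) + t / β ^ (n + 1) = lastPoint β n + ((D + t) / β) / β ^ n := by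
      rw [lastPoint_succ hβ, hD]; push_cast; field_simp; ring
    have h2 : t < β * leftOrbit β n - D := by
      rw [leftOrbit] at ht'; rw [hD]; push_cast; exact ht'
    rw [Function.iterate_succ_apply', h1, ih (by positivity)
      (by rw [div_lt_iff₀ hb]; linarith), betaMap_eq_fract, mul_div_cancel₀ _ hb.ne',
      Int.fract_intCast_add, Int.fract_eq_self]
    exact ⟨ht, ht'.trans_le (leftOrbit_le_one β _)⟩

/-- The rightmost cylinder is mapped onto `[0, leftOrbit β n)`. A next digit below the largest
admissible one satisfies `d + 1 < β * leftOrbit β n`, so its subcylinder is not truncated. -/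
theorem lastPoint_add_mem_fullPoints {β : ℝ} (hβ : 1 < β) {n : ℕ} {d : ℤ} (hd : 0 ≤ d)
    (hd' : d < ⌈β * leftOrbit β n⌉ - 1) :
    lastPoint β n + d / β ^ (n + 1) ∈ fullPoints β (n + 1) := by
  have hb : 0 < β := by positivity
  have hd0 : (0 : ℝ) ≤ d := by exact_mod_cast hd
  have h1 : (d : ℝ) + 1 < β * leftOrbit β n := by
    have : d + 1 < ⌈β * leftOrbit β n⌉ := by omega
    exact_mod_cast Int.lt_ceil.1 this
  refine ⟨?_, ?_, fun t ht ht' => ?_⟩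
  · have := lastPoint_nonneg hβ n
    positivity
  · have : (d + 1 : ℝ) / β ^ (n + 1) ≤ β * leftOrbit β n / β ^ (n + 1) := by gcongr
    have h3 : β * leftOrbit β n / β ^ (n + 1) = leftOrbit β n / β ^ n := by
      field_simp
      ring
    rw [lastPoint]
    rw [h3, add_div] at this
    linarith
  · have h2 : lastPoint β n + d / β ^ (n + 1) + t / β ^ (n + 1)
        = lastPoint β n + ((d + t) / β) / β ^ n := by
      field_simp; ring
    rw [Function.iterate_succ_apply', h2, betaMap_iterate_lastPoint hβ n (by positivity)
      (by rw [div_lt_iff₀ hb]; linarith), betaMap_eq_fract, mul_div_cancel₀ _ hb.ne',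
      Int.fract_intCast_add, Int.fract_eq_self]
    exact ⟨ht, ht'⟩

/-- Every point lies in a cylinder of order `n` which is the rightmost cylinder of order `k` inside
a full cylinder of order `n - k`. -/
theorem exists_mem_fullPoints_cover {β : ℝ} (hβ : 1 < β) {x : ℝ} (hx : x ∈ Set.Ico (0 : ℝ) 1)
    (n : ℕ) : ∃ m k : ℕ, m + k = n ∧ ∃ a ∈ fullPoints β m, ∃ t : ℝ, lastPoint β k ≤ t ∧ t < 1 ∧
      x = a + t / β ^ m := by
  have hb : 0 < β := by positivity
  induction n with
  | zero => exact ⟨0, 0, rfl, 0, zero_mem_fullPoints hβ 0, x, by simp [lastPoint, leftOrbit, hx.1],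
      hx.2, by simp⟩
  | succ n ih =>
    obtain ⟨m, k, hmk, a, ha, t, ht, ht', rfl⟩ := ih
    set y := (t - lastPoint β k) * β ^ k with hy
    have hy0 : 0 ≤ y := mul_nonneg (by linarith) (by positivity)
    have hty : t = lastPoint β k + y / β ^ k := by rw [hy]; field_simp; ring
    have hyu : y < leftOrbit β k := by
      have h1 : y / β ^ k < leftOrbit β k / β ^ k := by
        rw [lastPoint] at hty; linarith
      exact (div_lt_div_iff_of_pos_right (by positivity)).1 h1
    have hfl : (⌊β * y⌋ : ℝ) ≤ β * y := Int.floor_le _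
    have hfl' : β * y < ⌊β * y⌋ + 1 := Int.lt_floor_add_one _
    have hd0 : 0 ≤ ⌊β * y⌋ := Int.floor_nonneg.2 (by positivity)
    have hyt : ∀ d : ℝ, t = lastPoint β k + d / β ^ (k + 1) + (β * y - d) / β ^ (k + 1) := by
      intro d
      rw [hty]; field_simp; ring
    -- A digit below the top one completes a full cylinder, and `k` restarts at `0`; the top digit
    -- extends the rightmost word.
    rcases lt_or_ge ⌊β * y⌋ (⌈β * leftOrbit β k⌉ - 1) with h | h
    · refine ⟨m + (k + 1), 0, by omega, _, add_div_mem_fullPoints hβ ha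
        (lastPoint_add_mem_fullPoints hβ hd0 h), β * y - ⌊β * y⌋, ?_, by linarith, ?_⟩
      · simp [lastPoint, leftOrbit]
      · conv_lhs => rw [hyt ⌊β * y⌋]
        rw [pow_add β m (k + 1)]; field_simp; ring
    · refine ⟨m, k + 1, by omega, a, ha, t, ?_, ht', rfl⟩
      have h2 : ((⌈β * leftOrbit β k⌉ - 1 : ℤ) : ℝ) ≤ ⌊β * y⌋ := by exact_mod_cast h
      push_cast at h2
      have h1 := hyt (⌈β * leftOrbit β k⌉ - 1)
      rw [← lastPoint_succ hβ] at h1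
      have h3 : 0 ≤ (β * y - (⌈β * leftOrbit β k⌉ - 1)) / β ^ (k + 1) :=
        div_nonneg (by linarith) (by positivity)
      linarith

/-- A lower bound for the number of full cylinders of order `n`. -/
theorem pow_le_ncard_fullPoints {β : ℝ} (hβ : 1 < β) (n : ℕ) :
    β ^ n ≤ (n + 1) * (fullPoints β n).ncard := by
  have hb : 0 < β := by positivity
  have hF := fullPoints_finite hβ n
  set I : ℕ → ℝ → Set ℝ := fun m a =>
    Set.Ico (a + lastPoint β (n - m) / β ^ m) (a + 1 / β ^ m) with hI
  -- By `fullPoints_mono` every `a` may be taken in `fullPoints β n`. This gives `n + 1` intervals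
  -- of length at most `β ^ (-n)` per full point, and total length at least `1` forces the count.
  have hcov : Set.Ico (0 : ℝ) 1 ⊆
      ⋃ m ∈ Finset.range (n + 1), ⋃ a ∈ hF.toFinset, I m a := by
    intro x hx
    obtain ⟨m, k, hmk, a, ha, t, ht, ht', rfl⟩ := exists_mem_fullPoints_cover hβ hx n
    simp only [Set.mem_iUnion, Finset.mem_range, Set.Finite.mem_toFinset, exists_prop]
    refine ⟨m, by omega, a, fullPoints_mono hβ (by omega) ha, ?_, ?_⟩
    · have : n - m = k := by omega
      rw [this]; gcongr
    · gcongr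
  have hvol : ∀ m ∈ Finset.range (n + 1), ∀ a,
      MeasureTheory.volume (I m a) ≤ ENNReal.ofReal (1 / β ^ n) := by
    intro m hm a
    rw [Finset.mem_range] at hm
    rw [hI, Real.volume_Ico]
    apply ENNReal.ofReal_le_ofReal
    have h1 : a + 1 / β ^ m - (a + lastPoint β (n - m) / β ^ m) =
        leftOrbit β (n - m) / β ^ (n - m) / β ^ m := by
      rw [lastPoint]; field_simp; ring
    rw [h1, div_div, ← pow_add, Nat.sub_add_cancel (by omega)]
    gcongr
    exact leftOrbit_le_one β _
  have h1 : MeasureTheory.volume (Set.Ico (0 : ℝ) 1) ≤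
      ∑ m ∈ Finset.range (n + 1), ∑ a ∈ hF.toFinset, ENNReal.ofReal (1 / β ^ n) :=
    (MeasureTheory.measure_mono hcov).trans <| (MeasureTheory.measure_biUnion_finset_le _ _).trans <|
      Finset.sum_le_sum fun m hm => (MeasureTheory.measure_biUnion_finset_le _ _).trans <|
        Finset.sum_le_sum fun a _ => hvol m hm a
  rw [Real.volume_Ico, Finset.sum_const, Finset.sum_const, Finset.card_range,
    ← Set.ncard_eq_toFinset_card _ hF, ← ENNReal.ofReal_nsmul, ← ENNReal.ofReal_nsmul,
    ENNReal.ofReal_le_ofReal_iff (by positivity)] at h1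
  simp only [nsmul_eq_mul, Nat.cast_add, Nat.cast_one] at h1
  have h2 : (0 : ℝ) < β ^ n := by positivity
  have h3 : ((n : ℝ) + 1) * ((fullPoints β n).ncard * (1 / β ^ n)) =
    ((n : ℝ) + 1) * (fullPoints β n).ncard / β ^ n := by ring
  rw [h3, le_div_iff₀ h2] at h1
  linarith

end BetaExpansion

/-! ### Runs of zeros in terms of the orbit -/

namespace BetaExpansion

/-- While digits vanish, the map is plain multiplication by `β`. -/
theorem forall_digit_eq_zero_iff {β : ℝ} (hβ : 1 < β) {x : ℝ} (hx : x ∈ Set.Ico (0 : ℝ) 1)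
    (i k : ℕ) : (∀ j : ℕ, 1 ≤ j → j ≤ k → digit β x (i + j) = 0) ↔
      (betaMap β)^[i] x * β ^ k < 1 := by
  have hb : 0 < β := by positivity
  have hi := betaMap_iterate_mem β hx i
  induction k with
  | zero => simp only [pow_zero, mul_one, hi.2, iff_true]; omega
  | succ k ih =>
    have hdig : (betaMap β)^[i] x * β ^ k < 1 →
        (digit β x (i + (k + 1)) = 0 ↔ (betaMap β)^[i] x * β ^ (k + 1) < 1) := by
      intro h
      rw [digit, show i + (k + 1) - 1 = k + i by omega, Function.iterate_add_apply,
        betaMap_iterate_of_lt hβ hi.1 h, Int.floor_eq_zero_iff, Set.mem_Ico, mul_comm β,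
        mul_assoc, ← pow_succ]
      exact and_iff_right (mul_nonneg hi.1 (by positivity))
    constructor
    · intro h
      have h1 := ih.1 fun j h1 h2 => h j h1 (by omega)
      exact (hdig h1).1 (h (k + 1) (by omega) le_rfl)
    · intro h j h1 h2
      have h3 : (betaMap β)^[i] x * β ^ k < 1 := by
        refine lt_of_le_of_lt ?_ h
        exact mul_le_mul_of_nonneg_left (pow_le_pow_right₀ hβ.le (by omega)) hi.1
      rcases Nat.lt_or_ge k j with h4 | h4
      · obtain rfl : j = k + 1 := by omega
        exact (hdig h3).2 h
      · exact ih.2 h3 j h1 h4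

theorem le_runLength {β : ℝ} (hβ : 1 < β) {x : ℝ} (hx : x ∈ Set.Ico (0 : ℝ) 1) {i k n : ℕ}
    (hn : i + k ≤ n) (h : (betaMap β)^[i] x * β ^ k < 1) : k ≤ runLength β x n := by
  refine le_csSup ⟨n, ?_⟩ ⟨i, hn, (forall_digit_eq_zero_iff hβ hx i k).2 h⟩
  rintro k ⟨i, hi, -⟩
  omega

theorem exists_runLength {β : ℝ} (hβ : 1 < β) {x : ℝ} (hx : x ∈ Set.Ico (0 : ℝ) 1) (n : ℕ) :
    ∃ i, i + runLength β x n ≤ n ∧ (betaMap β)^[i] x * β ^ runLength β x n < 1 := by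
  have h : runLength β x n ∈ {k : ℕ | ∃ i : ℕ, i + k ≤ n ∧
      ∀ j : ℕ, 1 ≤ j → j ≤ k → digit β x (i + j) = 0} :=
    Nat.sSup_mem ⟨0, 0, by omega, by omega⟩ ⟨n, by rintro k ⟨i, hi, -⟩; omega⟩
  obtain ⟨i, hi, h⟩ := h
  exact ⟨i, hi, (forall_digit_eq_zero_iff hβ hx i _).1 h⟩

/-! ### Points with prescribed blocks -/

section Series

/-- The partial sums of the series whose `i`-th term is `a i / β ^ S i`. -/
noncomputable def partialSum (β : ℝ) (S : ℕ → ℕ) (a : ℕ → ℝ) (n : ℕ) : ℝ :=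
  ∑ i ∈ Finset.range n, a i / β ^ S i

/-- The point whose expansion is the concatenation of the words coded by the points `a i`, the
`i`-th of them starting after position `S i`. -/
noncomputable def blockPoint (β : ℝ) (S : ℕ → ℕ) (a : ℕ → ℝ) : ℝ := ⨆ n, partialSum β S a n

/-- The image of `blockPoint β S a` under the iterate of order `S n`. -/
noncomputable def blockTail (β : ℝ) (S : ℕ → ℕ) (a : ℕ → ℝ) (n : ℕ) : ℝ :=
  (blockPoint β S a - partialSum β S a n) * β ^ S n

/-- The `j`-th block is a nonzero full word of length `L` followed by at least one zero. -/
structure IsBlockCode (β : ℝ) (L : ℕ) (S : ℕ → ℕ) (a : ℕ → ℝ) : Prop where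
  zero : S 0 = 0
  lt_succ : ∀ j, S j + L < S (j + 1)
  mem : ∀ j, a j ∈ fullPoints β L
  ne_zero : ∀ j, a j ≠ 0

variable {β : ℝ} {L : ℕ} {S : ℕ → ℕ} {a : ℕ → ℝ}

theorem partialSum_succ (n : ℕ) :
    partialSum β S a (n + 1) = partialSum β S a n + a n / β ^ S n :=
  Finset.sum_range_succ _ _

theorem blockPoint_eq (hβ : 1 < β) (n : ℕ) :
    blockPoint β S a = partialSum β S a n + blockTail β S a n / β ^ S n := by
  rw [blockTail, mul_div_cancel_right₀ _ (by positivity), add_sub_cancel]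

theorem blockTail_eq (hβ : 1 < β) (h : IsBlockCode β L S a) (n : ℕ) :
    blockTail β S a n = a n + blockTail β S a (n + 1) / β ^ (S (n + 1) - S n) := by
  have h1 : S n ≤ S (n + 1) := by have := h.lt_succ n; omega
  have h2 : β ^ S (n + 1) = β ^ (S (n + 1) - S n) * β ^ S n := by
    rw [← pow_add, Nat.sub_add_cancel h1]
  rw [blockTail, blockTail, partialSum_succ, h2]
  field_simp
  ring

theorem le_one_div_pow (hβ : 1 < β) (h : IsBlockCode β L S a) (n : ℕ) :
    1 / β ^ (S (n + 1) - S n) ≤ 1 / β ^ L * β⁻¹ := by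
  have h1 := h.lt_succ n
  have : 1 / β ^ L * β⁻¹ = 1 / β ^ (L + 1) := by rw [pow_succ]; field_simp
  rw [this]
  exact one_div_le_one_div_of_le (by positivity) (pow_le_pow_right₀ hβ.le (by omega))

theorem partialSum_mono (hβ : 1 < β) (h : IsBlockCode β L S a) :
    Monotone (partialSum β S a) := by
  refine monotone_nat_of_le_succ fun n => ?_
  rw [partialSum_succ]
  have := (h.mem n).1
  have : 0 ≤ a n / β ^ S n := by positivity
  linarith

/-- These are the right endpoints of nested full cylinders. -/
theorem partialSum_add_antitone (hβ : 1 < β) (h : IsBlockCode β L S a) :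
    Antitone fun n => partialSum β S a n + 1 / β ^ S n := by
  refine antitone_nat_of_succ_le fun n => ?_
  have h1 := (h.mem n).2.1
  have h2 : S (n + 1) = L + S n + (S (n + 1) - S n - L) := by have := h.lt_succ n; omega
  have h3 : 1 / β ^ S (n + 1) ≤ 1 / β ^ L / β ^ S n := by
    rw [div_div, ← pow_add]
    exact one_div_le_one_div_of_le (by positivity) (pow_le_pow_right₀ hβ.le (by omega))
  have h4 : (a n + 1 / β ^ L) / β ^ S n ≤ 1 / β ^ S n := by gcongr
  rw [add_div] at h4
  rw [partialSum_succ]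
  linarith

theorem partialSum_le_add (hβ : 1 < β) (h : IsBlockCode β L S a) (m n : ℕ) :
    partialSum β S a m ≤ partialSum β S a n + 1 / β ^ S n := by
  have h1 := partialSum_mono hβ h (le_max_left m n)
  have h2 := partialSum_add_antitone hβ h (le_max_right m n)
  have h3 : 0 < 1 / β ^ S (max m n) := by positivity
  simp only at h2
  linarith

theorem blockTail_nonneg (hβ : 1 < β) (h : IsBlockCode β L S a) (n : ℕ) :
    0 ≤ blockTail β S a n := by
  refine mul_nonneg (sub_nonneg.2 (le_ciSup ⟨partialSum β S a 0 + 1 / β ^ S 0, ?_⟩ n)) (by positivity)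
  rintro _ ⟨m, rfl⟩
  exact partialSum_le_add hβ h m 0

theorem blockTail_le_one (hβ : 1 < β) (h : IsBlockCode β L S a) (n : ℕ) :
    blockTail β S a n ≤ 1 := by
  have h1 : blockPoint β S a ≤ partialSum β S a n + 1 / β ^ S n :=
    ciSup_le fun m => partialSum_le_add hβ h m n
  rw [blockTail, ← le_div_iff₀ (by positivity)]
  linarith

/-- The factor `β⁻¹` comes from the zero after each word. It keeps tails strictly below `1` and
leaves a definite gap between distinct blocks. -/
theorem blockTail_div_le (hβ : 1 < β) (h : IsBlockCode β L S a) (n : ℕ) :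
    blockTail β S a (n + 1) / β ^ (S (n + 1) - S n) ≤ 1 / β ^ L * β⁻¹ := by
  refine le_trans ?_ (le_one_div_pow hβ h n)
  gcongr
  exact blockTail_le_one hβ h _

theorem one_div_pow_mul_inv_lt (hβ : 1 < β) (L : ℕ) : 1 / β ^ L * β⁻¹ < 1 / β ^ L :=
  mul_lt_of_lt_one_right (by positivity) (inv_lt_one_of_one_lt₀ hβ)

theorem blockTail_lt_one (hβ : 1 < β) (h : IsBlockCode β L S a) (n : ℕ) :
    blockTail β S a n < 1 := by
  have h1 := blockTail_div_le hβ h n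
  have h2 := one_div_pow_mul_inv_lt hβ L
  have h3 := (h.mem n).2.1
  rw [blockTail_eq hβ h]
  linarith

theorem blockPoint_mem (hβ : 1 < β) (h : IsBlockCode β L S a) :
    blockPoint β S a ∈ Set.Ico (0 : ℝ) 1 := by
  have : blockPoint β S a = blockTail β S a 0 := by simp [blockTail, partialSum, h.zero]
  rw [this]
  exact ⟨blockTail_nonneg hβ h 0, blockTail_lt_one hβ h 0⟩

theorem partialSum_add_mem (hβ : 1 < β) (h : IsBlockCode β L S a) {n : ℕ}
    (hn : partialSum β S a n ∈ fullPoints β (S n)) :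
    partialSum β S a (n + 1) ∈ fullPoints β (S n + L) := by
  rw [partialSum_succ]
  exact add_div_mem_fullPoints hβ hn (h.mem n)

theorem partialSum_mem (hβ : 1 < β) (h : IsBlockCode β L S a) (n : ℕ) :
    partialSum β S a n ∈ fullPoints β (S n) := by
  induction n with
  | zero => simpa [partialSum] using zero_mem_fullPoints hβ (S 0)
  | succ n ih => exact fullPoints_mono hβ (h.lt_succ n).le (partialSum_add_mem hβ h ih)

theorem iterate_blockPoint (hβ : 1 < β) (h : IsBlockCode β L S a) (n : ℕ) :
    (betaMap β)^[S n] (blockPoint β S a) = blockTail β S a n := by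
  rw [blockPoint_eq hβ n]
  exact (partialSum_mem hβ h n).2.2 _ (blockTail_nonneg hβ h n) (blockTail_lt_one hβ h n)

theorem iterate_add_blockPoint (hβ : 1 < β) (h : IsBlockCode β L S a) (n : ℕ) :
    (betaMap β)^[S n + L] (blockPoint β S a) =
      blockTail β S a (n + 1) / β ^ (S (n + 1) - (S n + L)) := by
  have h0 := h.lt_succ n
  have h1 : blockPoint β S a = partialSum β S a (n + 1) +
      blockTail β S a (n + 1) / β ^ (S (n + 1) - (S n + L)) / β ^ (S n + L) := by
    rw [div_div, ← pow_add, Nat.sub_add_cancel h0.le, ← blockPoint_eq hβ]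
  have h2 : blockTail β S a (n + 1) / β ^ (S (n + 1) - (S n + L)) ≤ blockTail β S a (n + 1) :=
    div_le_self (blockTail_nonneg hβ h _) (one_le_pow₀ hβ.le)
  have h3 := blockTail_nonneg hβ h (n + 1)
  conv_lhs => rw [h1]
  exact (partialSum_add_mem hβ h (partialSum_mem hβ h n)).2.2 _ (by positivity)
    (h2.trans_lt (blockTail_lt_one hβ h _))

/-- `0` is itself a full point, so the nonzero `a n` is separated from it. -/
theorem one_div_pow_le_blockTail (hβ : 1 < β) (h : IsBlockCode β L S a) (n : ℕ) :
    1 / β ^ L ≤ blockTail β S a n := by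
  have h1 := fullPoints_separated hβ (zero_mem_fullPoints hβ L) (h.mem n)
    ((h.mem n).1.lt_of_ne (h.ne_zero n).symm)
  have h2 := blockTail_nonneg hβ h (n + 1)
  have h3 : 0 ≤ blockTail β S a (n + 1) / β ^ (S (n + 1) - S n) := by positivity
  rw [blockTail_eq hβ h]
  linarith

/-- A run of zeros starting before the end of a block does not extend beyond the nonzero word of
the next block. -/
theorem add_lt_of_iterate_lt (hβ : 1 < β) (h : IsBlockCode β L S a) {i k j : ℕ}
    (hij : i ≤ S j) (hik : (betaMap β)^[i] (blockPoint β S a) * β ^ k < 1) :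
    i + k < S j + L := by
  by_contra! hlt
  have hi := betaMap_iterate_mem β (blockPoint_mem hβ h) i
  obtain ⟨d, hd⟩ := Nat.exists_eq_add_of_le hij
  have h1 : (betaMap β)^[i] (blockPoint β S a) * β ^ (d + L) < 1 :=
    (mul_le_mul_of_nonneg_left (pow_le_pow_right₀ hβ.le (by omega)) hi.1).trans_lt hik
  have h2 : (betaMap β)^[i] (blockPoint β S a) * β ^ d < 1 :=
    (mul_le_mul_of_nonneg_left (pow_le_pow_right₀ hβ.le (by omega)) hi.1).trans_lt h1
  have h3 := one_div_pow_le_blockTail hβ h j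
  rw [← iterate_blockPoint hβ h, hd, add_comm i d, Function.iterate_add_apply,
    betaMap_iterate_of_lt hβ hi.1 h2, div_le_iff₀ (by positivity), mul_assoc, ← pow_add] at h3
  linarith

theorem le_runLength_blockPoint (hβ : 1 < β) (h : IsBlockCode β L S a) (j : ℕ) :
    S (j + 1) - (S j + L) ≤ runLength β (blockPoint β S a) (S (j + 1)) := by
  have h0 := h.lt_succ j
  refine le_runLength hβ (blockPoint_mem hβ h) (i := S j + L) (by omega) ?_
  rw [iterate_add_blockPoint hβ h, div_mul_cancel₀ _ (by positivity)]
  exact blockTail_lt_one hβ h _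

theorem exists_le_lt_succ {S : ℕ → ℕ} (h : ∀ j, S j < S (j + 1)) {i : ℕ} (hi : S 0 ≤ i) :
    ∃ j, S j ≤ i ∧ i < S (j + 1) := by
  have hm : StrictMono S := strictMono_nat_of_lt_succ h
  have hex : ∃ j, i < S (j + 1) := ⟨i, (Nat.lt_succ_self i).trans_le hm.le_apply⟩
  refine ⟨Nat.find hex, ?_, Nat.find_spec hex⟩
  rcases Nat.eq_zero_or_pos (Nat.find hex) with h0 | h0
  · rwa [h0]
  · have h1 := Nat.find_min hex (m := Nat.find hex - 1) (by omega)
    rwa [Nat.sub_add_cancel h0, not_lt] at h1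

/-- A run starting in block `j` stops within the word of block `j + 1`, so it exceeds the gap by at
most two words. If `n` precedes the gap of block `j`, the run fits in one word; otherwise `S j + L ≤
n` allows comparison with `φ n`. -/
theorem runLength_blockPoint_le (hβ : 1 < β) (h : IsBlockCode β L S a) (n : ℕ) :
    runLength β (blockPoint β S a) n ≤ L ∨
      ∃ j, S j + L ≤ n ∧
        runLength β (blockPoint β S a) n ≤ S (j + 1) - (S j + L) + 2 * L := by
  obtain ⟨i, hi, hlt⟩ := exists_runLength hβ (blockPoint_mem hβ h) n
  obtain ⟨j, hj, hj'⟩ := exists_le_lt_succ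
    (fun j => (Nat.le_add_right _ _).trans_lt (h.lt_succ j)) (h.zero.trans_le (Nat.zero_le i))
  have h1 := add_lt_of_iterate_lt hβ h hj'.le hlt
  have h2 := h.lt_succ j
  by_cases hn : S j + L ≤ n
  · exact Or.inr ⟨j, hn, by omega⟩
  · exact Or.inl (by omega)

theorem partialSum_congr {b : ℕ → ℝ} {j : ℕ} (hab : ∀ i < j, a i = b i) :
    partialSum β S a j = partialSum β S b j :=
  Finset.sum_congr rfl fun i hi => by rw [hab i (Finset.mem_range.1 hi)]

/-- The distinct full words are `β ^ (-L)` apart, and the tail of the smaller one recovers at most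
the fraction `β⁻¹` of this. -/
theorem le_abs_blockPoint_sub (hβ : 1 < β) {b : ℕ → ℝ} (ha : IsBlockCode β L S a)
    (hb : IsBlockCode β L S b) {j : ℕ} (hab : ∀ i < j, a i = b i) (hj : a j ≠ b j) :
    1 / β ^ L * (1 - β⁻¹) / β ^ S j ≤ |blockPoint β S a - blockPoint β S b| := by
  have key : ∀ a b : ℕ → ℝ, IsBlockCode β L S a → IsBlockCode β L S b → a j < b j →
      1 / β ^ L * (1 - β⁻¹) ≤ blockTail β S b j - blockTail β S a j := by
    intro a b ha hb hlt
    have h1 := fullPoints_separated hβ (ha.mem j) (hb.mem j) hlt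
    have h2 := blockTail_div_le hβ ha j
    have h3 := blockTail_nonneg hβ hb (j + 1)
    have h4 : 0 ≤ blockTail β S b (j + 1) / β ^ (S (j + 1) - S j) := by positivity
    rw [blockTail_eq hβ ha, blockTail_eq hβ hb]
    linarith
  have h1 : blockPoint β S a - blockPoint β S b =
      (blockTail β S a j - blockTail β S b j) / β ^ S j := by
    rw [blockPoint_eq (a := a) hβ j, blockPoint_eq (a := b) hβ j, partialSum_congr hab]; ring
  rw [h1, abs_div, abs_of_pos (show (0 : ℝ) < β ^ S j by positivity)]
  gcongr
  rcases lt_or_gt_of_ne hj with h | h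
  · rw [abs_sub_comm]
    exact (key a b ha hb h).trans (le_abs_self _)
  · exact (key b a hb ha h).trans (le_abs_self _)

end Series

end BetaExpansion

/-! ### Growth of `φ`, block positions and the limsup -/

namespace BetaExpansion

/-- Along the orbit of `n ↦ n + ⌊φ n⌋`, each step raises `φ` by at most `ε * φ n ≤ 2 * ε * ⌊φ n⌋`,
that is, `2 * ε` times the step length. Monotonicity fills in between orbit points at the cost of a
factor `2`. -/
theorem SlowGrowth.eventually_le_mul {φ : ℕ → ℝ} (hφ : SlowGrowth φ) {δ : ℝ} (hδ : 0 < δ) :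
    ∀ᶠ n : ℕ in atTop, φ n ≤ δ * n := by
  set ε := min (δ / 8) 1 with hε
  have hε0 : 0 < ε := lt_min (by positivity) one_pos
  have hε1 : ε ≤ 1 := min_le_right _ _
  have hε2 : ε ≤ δ / 8 := min_le_left _ _
  obtain ⟨N, hN⟩ := eventually_atTop.1 <|
    (hφ.tendsto_ratio.eventually (eventually_le_nhds (show (1 : ℝ) < 1 + ε by linarith))).and <|
      (hφ.tendsto_atTop.eventually_ge_atTop 1).and (eventually_ge_atTop 1)
  set g : ℕ → ℕ := fun i => (fun n => n + ⌊φ n⌋₊)^[i] N with hg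
  have hg1 : ∀ i, g (i + 1) = g i + ⌊φ (g i)⌋₊ := fun i => Function.iterate_succ_apply' _ _ _
  have hgN : ∀ i, N ≤ g i := by
    intro i
    induction i with
    | zero => exact le_rfl
    | succ i ih => rw [hg1]; omega
  have hfl : ∀ i, 1 ≤ ⌊φ (g i)⌋₊ := fun i => by
    rw [Nat.one_le_floor_iff]; exact (hN _ (hgN i)).2.1
  have hstep : ∀ i, φ (g (i + 1)) ≤ (1 + ε) * φ (g i) := fun i => by
    have h := hN _ (hgN i)
    rw [hg1, ← div_le_iff₀ (by linarith [h.2.1])]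
    exact h.1
  have hbd : ∀ i, φ (g i) ≤ φ N + 2 * ε * g i := by
    intro i
    induction i with
    | zero =>
      have : 0 ≤ 2 * ε * g 0 := by positivity
      exact le_add_of_nonneg_right this
    | succ i ih =>
      have h1 : φ (g i) ≤ 2 * (⌊φ (g i)⌋₊ : ℝ) := by
        have h2 := Nat.lt_floor_add_one (φ (g i))
        have h3 : (1 : ℝ) ≤ ⌊φ (g i)⌋₊ := by exact_mod_cast hfl i
        linarith
      have h2 := hstep i
      have h3 : ε * φ (g i) ≤ ε * (2 * (⌊φ (g i)⌋₊ : ℝ)) := by gcongr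
      have h4 : (g (i + 1) : ℝ) = g i + ⌊φ (g i)⌋₊ := by rw [hg1]; push_cast; ring
      rw [h4]
      linarith
  filter_upwards [eventually_ge_atTop N, eventually_ge_atTop ⌈4 * φ N / δ⌉₊] with n hn hn'
  obtain ⟨i, hi, hi'⟩ := exists_le_lt_succ (S := g)
    (fun j => by rw [hg1]; have := hfl j; omega) (i := n) hn
  have h1 : 4 * φ N ≤ n * δ := by
    rw [← div_le_iff₀ hδ]; exact Nat.ceil_le.1 hn'
  have h2 : φ n ≤ φ (g (i + 1)) := hφ.mono _ _ ((hN N le_rfl).2.2.trans hn) hi'.le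
  have h3 : φ (g (i + 1)) ≤ 2 * φ (g i) := (hstep i).trans <|
    mul_le_mul_of_nonneg_right (by linarith) (by linarith [(hN _ (hgN i)).2.1])
  have h4 : ε * g i ≤ δ / 8 * n := by
    have : (g i : ℝ) ≤ n := by exact_mod_cast hi
    gcongr
  linarith [hbd i]

/-- The starting positions of the blocks. The `j`-th block consists of a word of length `L` and of
`⌊φ (S j + L)⌋` zeros, as long as this keeps the positions below `(L + 2) * j`, and of a word of
length `L` and a single zero otherwise. -/
noncomputable def positions (φ : ℕ → ℝ) (L : ℕ) : ℕ → ℕ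
  | 0 => 0
  | j + 1 =>
    if positions φ L j + L + ⌊φ (positions φ L j + L)⌋₊ ≤ (L + 2) * (j + 1) ∧
        1 ≤ ⌊φ (positions φ L j + L)⌋₊ then
      positions φ L j + L + ⌊φ (positions φ L j + L)⌋₊
    else positions φ L j + L + 1

theorem positions_le (φ : ℕ → ℝ) (L j : ℕ) : positions φ L j ≤ (L + 2) * j := by
  induction j with
  | zero => exact le_rfl
  | succ j ih =>
    rw [positions]
    split_ifs with h
    · exact h.1
    · rw [mul_add]; omega

theorem positions_add_lt (φ : ℕ → ℝ) (L j : ℕ) : positions φ L j + L < positions φ L (j + 1) := by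
  rw [positions]
  split_ifs with h <;> omega

theorem positions_succ (φ : ℕ → ℝ) (L j : ℕ) :
    positions φ L (j + 1) = positions φ L j + L + 1 ∨
      positions φ L (j + 1) = positions φ L j + L + ⌊φ (positions φ L j + L)⌋₊ := by
  rw [positions]
  split_ifs with h
  · exact Or.inr rfl
  · exact Or.inl rfl

theorem le_positions (φ : ℕ → ℝ) (L j : ℕ) : j ≤ positions φ L j := by
  have : StrictMono (positions φ L) :=
    strictMono_nat_of_lt_succ fun j => (Nat.le_add_right _ _).trans_lt (positions_add_lt φ L j)
  exact this.le_apply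

/-- A block with a single zero uses `L + 1` of its budget `L + 2`. If only such blocks occurred from
some point on, the slack would grow linearly and eventually pay for a gap of length `⌊φ n⌋ = o(n)`.
-/
theorem frequently_positions_succ {φ : ℕ → ℝ} (hφ : SlowGrowth φ) (L : ℕ) :
    ∃ᶠ j in atTop, positions φ L (j + 1) =
      positions φ L j + L + ⌊φ (positions φ L j + L)⌋₊ := by
  set S := positions φ L with hS
  have htop : Tendsto (fun j => S j + L) atTop atTop :=
    tendsto_atTop_mono (fun j => (le_positions φ L j).trans (Nat.le_add_right _ _)) tendsto_id
  rw [Filter.Frequently]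
  intro hcon
  -- Since `S j ≤ (L + 2) * j`, this makes `φ (S j + L) ≤ (j + 1) / 4`.
  have hδ : (0 : ℝ) < 1 / (4 * (L + 2)) := by positivity
  obtain ⟨J, hJ⟩ := eventually_atTop.1 <| hcon.and <|
    (htop.eventually (hφ.eventually_le_mul hδ)).and
      (htop.eventually (hφ.tendsto_atTop.eventually_ge_atTop 1))
  have hcond : ∀ j, J ≤ j → (L + 2) * (j + 1) < S j + L + ⌊φ (S j + L)⌋₊ := by
    intro j hj
    obtain ⟨h1, -, h3⟩ := hJ j hj
    by_contra! hle
    refine h1 ?_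
    rw [hS, positions, if_pos ⟨hle, by rwa [Nat.one_le_floor_iff]⟩]
  have hlin : ∀ i, S (J + i) = S J + (L + 1) * i := by
    intro i
    induction i with
    | zero => rfl
    | succ i ih =>
      have h1 := (positions_succ φ L (J + i)).resolve_right (hJ (J + i) (by omega)).1
      rw [← add_assoc, hS, h1, ← hS, ih]
      ring
  -- After `i` single-zero blocks the failed test would give `3 / 4 * i < S J`.
  set i := 2 * S J + 1 with hi
  have h1 := hcond (J + i) (by omega)
  have h2 := (hJ (J + i) (by omega)).2.1
  have h3 : (⌊φ (S (J + i) + L)⌋₊ : ℝ) ≤ φ (S (J + i) + L) :=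
    Nat.floor_le (zero_le_one.trans (hJ (J + i) (by omega)).2.2)
  have h4 : (S (J + i) : ℝ) ≤ (L + 2) * (J + i) := by exact_mod_cast positions_le φ L (J + i)
  have h5 : (1 : ℝ) / (4 * (L + 2)) * ((S (J + i) + L : ℕ) : ℝ) ≤ (J + i + 1) / 4 := by
    rw [div_mul_eq_mul_div, one_mul, div_le_div_iff₀ (by positivity) (by positivity)]
    push_cast
    nlinarith
  have h6 : ((L : ℝ) + 2) * (J + i + 1) < S (J + i) + L + ⌊φ (S (J + i) + L)⌋₊ := by
    exact_mod_cast h1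
  have h7 : (S (J + i) : ℝ) = S J + (L + 1) * i := by exact_mod_cast hlin i
  have h8 : (i : ℝ) = 2 * S J + 1 := by rw [hi]; push_cast; ring
  have h9 : (0 : ℝ) ≤ L * J := by positivity
  have h10 : (0 : ℝ) ≤ J := by positivity
  have h11 : (0 : ℝ) ≤ S J := by positivity
  nlinarith

/-- The constant `C` is negligible as `φ → ∞`. For the lower bound, the ratio condition replaces `φ
(n + ⌊φ n⌋)` by `φ n` in the denominator. -/
theorem limsup_runLength_eq_one {φ : ℕ → ℝ} (hφ : SlowGrowth φ) {r : ℕ → ℕ} {C : ℝ}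
    (hle : ∀ n, 1 ≤ n → (r n : ℝ) ≤ φ n + C)
    (hge : ∃ᶠ n in atTop, ⌊φ n⌋₊ ≤ r (n + ⌊φ n⌋₊)) :
    limsup (fun n : ℕ => (((r n : ℝ) / φ n : ℝ) : EReal)) atTop = 1 := by
  refine le_antisymm ?_ ?_
  · have h1 : Tendsto (fun n => (((1 + C / φ n : ℝ)) : EReal)) atTop (𝓝 ((1 : ℝ) : EReal)) := by
      refine (continuous_coe_real_ereal.tendsto _).comp ?_
      simpa using (hφ.tendsto_atTop.const_div_atTop C).const_add 1
    rw [← EReal.coe_one, ← h1.limsup_eq]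
    refine limsup_le_limsup ?_
    filter_upwards [eventually_ge_atTop 1] with n hn
    have hp := hφ.pos n hn
    rw [EReal.coe_le_coe_iff, div_le_iff₀ hp, add_mul, div_mul_cancel₀ _ hp.ne', one_mul]
    exact hle n hn
  · refine le_of_forall_lt fun b hb => ?_
    obtain ⟨c, hbc, hc⟩ := EReal.lt_iff_exists_real_btwn.1 hb
    refine hbc.trans_le (le_limsup_of_frequently_le' ?_)
    have hc1 : c < 1 := by exact_mod_cast hc
    have hfl : Tendsto (fun n => (⌊φ n⌋₊ : ℝ) / φ n) atTop (𝓝 1) :=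
      tendsto_nat_floor_div_atTop.comp hφ.tendsto_atTop
    have hlim : Tendsto (fun n => (⌊φ n⌋₊ : ℝ) / φ (n + ⌊φ n⌋₊)) atTop (𝓝 1) := by
      have h := hfl.div hφ.tendsto_ratio one_ne_zero
      rw [div_one] at h
      refine h.congr' ?_
      filter_upwards [eventually_ge_atTop 1] with n hn
      have h1 := hφ.pos n hn
      have h2 := hφ.pos (n + ⌊φ n⌋₊) (by omega)
      simp only [Pi.div_apply]
      field_simp
    have hev := (hlim.eventually (eventually_ge_nhds hc1)).and (eventually_ge_atTop 1)
    have htop : Tendsto (fun n => n + ⌊φ n⌋₊) atTop atTop :=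
      tendsto_atTop_mono (fun n => Nat.le_add_right _ _) tendsto_id
    refine htop.frequently ((hge.and_eventually hev).mono ?_)
    rintro n ⟨h1, h2, h3⟩
    have hp := hφ.pos (n + ⌊φ n⌋₊) (by omega)
    rw [EReal.coe_le_coe_iff]
    refine h2.trans ?_
    gcongr

theorem blockPoint_mem_runSet {β : ℝ} (hβ : 1 < β) {φ : ℕ → ℝ} (hφ : SlowGrowth φ) {L : ℕ}
    (hL : 1 ≤ L) {a : ℕ → ℝ} (h : IsBlockCode β L (positions φ L) a) :
    blockPoint β (positions φ L) a ∈ runSet β φ := by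
  -- Two words bordering the gap give `2 * L`; the extra `1` covers single-zero gaps.
  refine ⟨blockPoint_mem hβ h, limsup_runLength_eq_one hφ (C := 2 * L + 1) ?_ ?_⟩
  · intro n hn
    have hp := hφ.pos n hn
    rcases runLength_blockPoint_le hβ h n with h1 | ⟨j, hj, h1⟩
    · have h2 : (runLength β (blockPoint β (positions φ L) a) n : ℝ) ≤ L := by exact_mod_cast h1
      have h3 : (0 : ℝ) ≤ L := by positivity
      linarith
    · have hz : ((positions φ L (j + 1) - (positions φ L j + L) : ℕ) : ℝ) ≤ φ n + 1 := by
        rcases positions_succ φ L j with h2 | h2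
        · rw [h2, Nat.add_sub_cancel_left, Nat.cast_one]; linarith
        · rw [h2, Nat.add_sub_cancel_left]
          have h3 := Nat.floor_le (hφ.pos (positions φ L j + L) (by omega)).le
          have h4 := hφ.mono (positions φ L j + L) n (by omega) hj
          linarith
      have h2 : (runLength β (blockPoint β (positions φ L) a) n : ℝ) ≤
          ((positions φ L (j + 1) - (positions φ L j + L) : ℕ) : ℝ) + 2 * L := by
        exact_mod_cast h1
      linarith
  · have htop : Tendsto (fun j => positions φ L j + L) atTop atTop :=
      tendsto_atTop_mono (fun j => (le_positions φ L j).trans (Nat.le_add_right _ _)) tendsto_id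
    refine htop.frequently ((frequently_positions_succ hφ L).mono fun j hj => ?_)
    have h1 := le_runLength_blockPoint hβ h j
    rwa [hj, Nat.add_sub_cancel_left] at h1

/-! ### Dimension bound -/

/-- The exponential growth rate of the number of full cylinders is `log β`. -/
theorem exists_rpow_le_ncard_fullPoints {β : ℝ} (hβ : 1 < β) {s : ℝ} (hs : s < 1) :
    ∃ L : ℕ, 1 ≤ L ∧ (β ^ ((L + 2 : ℕ) * s) : ℝ) + 1 ≤ (fullPoints β L).ncard := by
  have hb : 0 < β := by positivity
  set q : ℝ := β ^ (s - 1) with hq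
  have hq0 : 0 ≤ q := by positivity
  have hq1 : q < 1 := Real.rpow_lt_one_of_one_lt_of_neg hβ (by linarith)
  have hβi : β⁻¹ < 1 := inv_lt_one_of_one_lt₀ hβ
  have hβi0 : 0 ≤ β⁻¹ := by positivity
  -- This is `(n + 1) * (β ^ ((n + 2) * s) + 1) / β ^ n`.
  have hlim : Tendsto (fun n : ℕ => (n * q ^ n + q ^ n) * β ^ (2 * s) + (n * β⁻¹ ^ n + β⁻¹ ^ n))
      atTop (𝓝 ((0 + 0) * β ^ (2 * s) + (0 + 0))) :=
    (((tendsto_self_mul_const_pow_of_lt_one hq0 hq1).add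
      (tendsto_pow_atTop_nhds_zero_of_lt_one hq0 hq1)).mul_const _).add
      ((tendsto_self_mul_const_pow_of_lt_one hβi0 hβi).add
        (tendsto_pow_atTop_nhds_zero_of_lt_one hβi0 hβi))
  simp only [add_zero, zero_mul] at hlim
  obtain ⟨L, hL, hL1⟩ :=
    ((hlim.eventually (eventually_le_nhds one_pos)).and (eventually_ge_atTop 1)).exists
  refine ⟨L, hL1, ?_⟩
  have hc := pow_le_ncard_fullPoints hβ L
  have hpow : (0 : ℝ) < β ^ L := by positivity
  have h1 : q ^ L * β ^ L = β ^ (L * s) := by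
    rw [hq, ← Real.rpow_natCast, ← Real.rpow_natCast β L, ← Real.rpow_mul hb.le,
      ← Real.rpow_add hb]
    ring_nf
  have h2 : β⁻¹ ^ L * β ^ L = 1 := by rw [← mul_pow, inv_mul_cancel₀ hb.ne', one_pow]
  have h3 : (β ^ ((L + 2 : ℕ) * s) : ℝ) = β ^ (L * s) * β ^ (2 * s) := by
    rw [← Real.rpow_add hb]; push_cast; ring_nf
  have h4 := mul_le_mul_of_nonneg_right hL hpow.le
  have h5 : ((L * q ^ L + q ^ L) * β ^ (2 * s) + (L * β⁻¹ ^ L + β⁻¹ ^ L)) * β ^ L =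
      (L + 1) * (q ^ L * β ^ L * β ^ (2 * s) + β⁻¹ ^ L * β ^ L) := by ring
  rw [h5, h1, h2, ← h3, one_mul] at h4
  exact le_of_mul_le_mul_left (h4.trans hc) (by positivity)

theorem exists_injective_fullPoints {β : ℝ} (hβ : 1 < β) {L M : ℕ}
    (hM : M + 1 = (fullPoints β L).ncard) : ∃ w : Fin M → ℝ, Function.Injective w ∧
      ∀ i, w i ∈ fullPoints β L ∧ w i ≠ 0 := by
  have hfin : (fullPoints β L \ {0}).Finite := (fullPoints_finite hβ L).sdiff
  have hcard : hfin.toFinset.card = M := by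
    rw [← Set.ncard_eq_toFinset_card _ hfin,
      Set.ncard_sdiff_singleton_of_mem (zero_mem_fullPoints hβ L), ← hM,
      Nat.add_sub_cancel]
  refine ⟨fun i => (hfin.toFinset.equivFinOfCardEq hcard).symm i,
    Subtype.val_injective.comp (Equiv.injective _), fun i => ?_⟩
  exact (Set.Finite.mem_toFinset hfin).1 ((hfin.toFinset.equivFinOfCardEq hcard).symm i).2

/-- A set parametrized by `M`-adic digits, in such a way that points which differ first at the digit
`j` have distance at least `κ * ρ ^ j` with `M⁻¹ ≤ ρ ^ s`, has dimension at least `s`. -/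
theorem le_dimH_range_of_digits {M : ℕ} (hM : 1 < M) {s : NNReal} (hs : 0 < s) {κ ρ : ℝ}
    (hκ : 0 < κ) (hρ : 0 < ρ) (hMρ : (M : ℝ)⁻¹ ≤ ρ ^ (s : ℝ)) {X : (ℕ → Fin M) → ℝ}
    (hX : ∀ (c d : ℕ → Fin M) (j : ℕ), (∀ i < j, c i = d i) → c j ≠ d j →
      κ * ρ ^ j ≤ |X c - X d|) : (s : ENNReal) ≤ dimH (Set.range X) := by
  have hfirst : ∀ c d : ℕ → Fin M, c ≠ d → ∃ j, (∀ i < j, c i = d i) ∧ c j ≠ d j := by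
    intro c d hcd
    have hex : ∃ j, c j ≠ d j := Function.ne_iff.1 hcd
    exact ⟨Nat.find hex, fun i hi => not_not.1 (Nat.find_min hex hi), Nat.find_spec hex⟩
  have hinj : Function.Injective X := by
    intro c d hcd
    by_contra hne
    obtain ⟨j, h1, h2⟩ := hfirst c d hne
    have h3 := hX c d j h1 h2
    rw [hcd, sub_self, abs_zero] at h3
    have : 0 < κ * ρ ^ j := by positivity
    linarith
  have : Nonempty (ℕ → Fin M) := ⟨fun _ => ⟨0, by omega⟩⟩
  -- The map `f` reads off the digits of a point as an `M`-adic expansion; it is `s`-Hölder on the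
  -- range of `X` and covers `[0, 1]`.
  set f : ℝ → ℝ := fun x => Real.ofDigits (Function.invFun X x) with hf
  have hfX : ∀ c, f (X c) = Real.ofDigits c := fun c => by
    rw [hf]; simp only [Function.leftInverse_invFun hinj c]
  have hhol : HolderOnWith (κ⁻¹ ^ (s : ℝ)).toNNReal s f (Set.range X) := by
    rintro _ ⟨c, rfl⟩ _ ⟨d, rfl⟩
    rw [hfX, hfX]
    rcases eq_or_ne c d with rfl | hne
    · simp
    obtain ⟨j, h1, h2⟩ := hfirst c d hne
    rw [edist_dist, edist_dist, ENNReal.ofReal_rpow_of_nonneg dist_nonneg s.coe_nonneg,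
      ENNReal.ofNNReal_toNNReal, ← ENNReal.ofReal_mul (by positivity), Real.dist_eq, Real.dist_eq]
    apply ENNReal.ofReal_le_ofReal
    calc |Real.ofDigits c - Real.ofDigits d| ≤ ((M : ℝ) ^ j)⁻¹ :=
          Real.abs_ofDigits_sub_ofDigits_le h1
      _ = (M : ℝ)⁻¹ ^ j := (inv_pow _ _).symm
      _ ≤ (ρ ^ (s : ℝ)) ^ j := by gcongr
      _ = (κ⁻¹ * (κ * ρ ^ j)) ^ (s : ℝ) := by
          rw [inv_mul_cancel_left₀ hκ.ne', ← Real.rpow_natCast, ← Real.rpow_natCast,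
            ← Real.rpow_mul hρ.le, ← Real.rpow_mul hρ.le, mul_comm]
      _ ≤ (κ⁻¹ * |X c - X d|) ^ (s : ℝ) := by
          have := hX c d j h1 h2
          gcongr
      _ = κ⁻¹ ^ (s : ℝ) * |X c - X d| ^ (s : ℝ) := Real.mul_rpow (by positivity) (abs_nonneg _)
  have himg : Set.Icc (0 : ℝ) 1 ⊆ f '' Set.range X := by
    intro y hy
    obtain ⟨c, -, hc⟩ := Real.ofDigits_SurjOn hM hy
    exact ⟨X c, ⟨c, rfl⟩, (hfX c).trans hc⟩
  have h1 : (1 : ENNReal) ≤ dimH (Set.range X) / s := by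
    have hI : dimH (Set.Icc (0 : ℝ) 1) = 1 := by
      rw [Real.dimH_of_mem_nhds (x := 1 / 2) (Icc_mem_nhds (by norm_num) (by norm_num)),
        Module.finrank_self, Nat.cast_one]
    rw [← hI]
    exact (dimH_mono himg).trans (hhol.dimH_image_le hs)
  have h2 := mul_le_mul_left h1 (s : ENNReal)
  rwa [one_mul, ENNReal.div_mul_cancel (by exact_mod_cast hs.ne') ENNReal.coe_ne_top] at h2

theorem le_dimH_runSet {β : ℝ} (hβ : 1 < β) {φ : ℕ → ℝ} (hφ : SlowGrowth φ) {s : NNReal}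
    (hs : 0 < s) (hs' : s < 1) : (s : ENNReal) ≤ dimH (runSet β φ) := by
  have hb : 0 < β := by positivity
  have hs0 : (0 : ℝ) < s := by exact_mod_cast hs
  obtain ⟨L, hL, hcard⟩ := exists_rpow_le_ncard_fullPoints hβ (s := s) (by exact_mod_cast hs')
  have hpow : (1 : ℝ) < β ^ ((L + 2 : ℕ) * (s : ℝ)) :=
    Real.one_lt_rpow hβ (by positivity)
  -- Discarding the zero word must leave `M ≥ 2` symbols.
  have hM2 : (2 : ℝ) < (fullPoints β L).ncard := by linarith
  have hM2' : 2 < (fullPoints β L).ncard := by exact_mod_cast hM2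
  obtain ⟨M, hM⟩ : ∃ M, M + 1 = (fullPoints β L).ncard :=
    ⟨(fullPoints β L).ncard - 1, by omega⟩
  obtain ⟨w, hw, hw'⟩ := exists_injective_fullPoints hβ hM
  have hMc : (M : ℝ) + 1 = (fullPoints β L).ncard := by exact_mod_cast hM
  have hcode : ∀ c : ℕ → Fin M, IsBlockCode β L (positions φ L) (w ∘ c) := fun c =>
    ⟨rfl, positions_add_lt φ L, fun j => (hw' (c j)).1, fun j => (hw' (c j)).2⟩
  have hβi : β⁻¹ < 1 := inv_lt_one_of_one_lt₀ hβ
  refine (le_dimH_range_of_digits (M := M) (by omega) hs (κ := 1 / β ^ L * (1 - β⁻¹))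
    (ρ := (β ^ (L + 2))⁻¹) (X := fun c => blockPoint β (positions φ L) (w ∘ c))
    (mul_pos (by positivity) (by linarith)) (by positivity) ?_ ?_).trans (dimH_mono ?_)
  · rw [Real.inv_rpow (by positivity), ← Real.rpow_natCast, ← Real.rpow_mul hb.le]
    exact inv_anti₀ (by positivity) (by linarith)
  · intro c d j h1 h2
    refine le_trans ?_ (le_abs_blockPoint_sub hβ (hcode c) (hcode d) (j := j)
      (fun i hi => congrArg w (h1 i hi)) (hw.ne h2))
    rw [div_eq_mul_inv, inv_pow, ← pow_mul]
    refine mul_le_mul_of_nonneg_left (inv_anti₀ (by positivity)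
      (pow_le_pow_right₀ hβ.le (positions_le φ L j))) (mul_nonneg (by positivity) (by linarith))
  · rintro _ ⟨c, rfl⟩
    exact blockPoint_mem_runSet hβ hφ hL (hcode c)

end BetaExpansion

theorem mainTheorem11 (β : ℝ) (hβ : 1 < β) (φ : ℕ → ℝ) (hφ : BetaExpansion.SlowGrowth φ) :
    dimH (BetaExpansion.runSet β φ) = 1 := by
  refine le_antisymm ((dimH_mono (Set.subset_univ _)).trans_eq Real.dimH_univ) ?_
  refine le_of_forall_lt fun b hb => ?_
  obtain ⟨s, hbs, hs⟩ := ENNReal.lt_iff_exists_nnreal_btwn.1 hb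
  have hs0 : 0 < s := by exact_mod_cast pos_of_gt hbs
  exact hbs.trans_le (BetaExpansion.le_dimH_runSet hβ hφ hs0 (by exact_mod_cast hs))
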